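/- Let $A$ be a definite quaternion algebra over $\mathbb{Q}$, that is, a four-dimensional central simple $\mathbb{Q}$-algebra such that $A\otimes_{\mathbb{Q}}\mathbb{R}$ is isomorphic to Hamilton's quaternion algebra $\mathbb{H}$. Fix an identification of $A\otimes_{\mathbb{Q}}\mathbb{R}$ with $\mathbb{H}$, so that $A\subset\mathbb{H}$, and let $\operatorname{n}(x)=x\overline{x}$ be the reduced norm. A $\mathbb{Z}$-lattice in $A$ is a finitely generated $\mathbb{Z}$-submodule generating $A$ as a $\mathbb{Q}$-vector space; an order in $A$ is a unitary subring which is a $\mathbb{Z}$-lattice; a left fractional ideal of an order $\mathcal{O}$ is a $\mathbb{Z}$-lattice $\mathfrak{m}$ of $A$ whose left order $\{x\in A : x\mathfrak{m}\subset\mathfrak{m}\}$ equals $\mathcal{O}$. If $\mathfrak{m}\subset\mathcal{O}$, its norm $\operatorname{n}(\mathfrak{m})$ is the greatest common divisor of the reduced norms of the nonzero elements of $\mathfrak{m}$; in general, $\operatorname{n}(\mathfrak{m})=\operatorname{n}(c\,\mathfrak{m})/\operatorname{n}(c)$ for any positive integer $c$ with $c\,\mathfrak{m}\subset\mathcal{O}$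 (this does not depend on $c$). Let $\mathcal{O}$ be a maximal order in $A$, let $z\in A-\{0\}$, and let $$\Lambda=\mathcal{O}\cap z\mathcal{O}\cap\mathcal{O}z\cap z\mathcal{O}z .$$ Then $\Lambda$ is a $\mathbb{Z}$-lattice in $A$ contained in $\mathcal{O}$, the $\mathbb{Z}$-module $\mathcal{O}z^{-1}+\mathcal{O}$ is a left fractional ideal of $\mathcal{O}$, and $$[\mathcal{O}:\Lambda]\;\operatorname{n}(\mathcal{O}z^{-1}+\mathcal{O})^4=1 .$$ -/

import Mathlib

open scoped TensorProduct Quaternion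

namespace DefiniteQuaternion

/-- A quaternion algebra over a field `F`: a four-dimensional central simple `F`-algebra. -/
structure IsQuaternionAlgebra (F A : Type*) [Field F] [Ring A] [Algebra F A] : Prop where
  isCentral : Algebra.IsCentral F A
  isSimpleRing : IsSimpleRing A
  finrank_eq_four : Module.finrank F A = 4

section ReducedNorm

variable {A : Type*} [Ring A] [Algebra ℚ A]

/-- The reduced norm of `x ∈ A`, where `A` is viewed inside Hamilton's quaternions through a fixed
identification `φ` of `A ⊗ ℝ` with `ℍ`: it is `n(x) = x * conj x`. -/
noncomputable def reducedNorm (φ : ℝ ⊗[ℚ] A ≃ₐ[ℝ] ℍ[ℝ]) (x : A) : ℝ :=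
  Quaternion.normSq (φ (1 ⊗ₜ[ℚ] x))

/-- The greatest common divisor of the reduced norms of the nonzero elements of `I`
(for `I` a left or right ideal of an order these are positive integers). -/
noncomputable def idealNorm (φ : ℝ ⊗[ℚ] A ≃ₐ[ℝ] ℍ[ℝ]) (I : Submodule ℤ A) : ℕ :=
  sSup {d : ℕ | ∀ x ∈ I, x ≠ 0 → ∃ k : ℤ, reducedNorm φ x = (d : ℝ) * k}

end ReducedNorm

section Lattices

variable {A : Type*} [Ring A]

/-- The translate `z L = {z * x | x ∈ L}`. -/
def mulL (z : A) (L : Submodule ℤ A) : Submodule ℤ A := L.map (LinearMap.mulLeft ℤ z)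

/-- The translate `L z = {x * z | x ∈ L}`. -/
def mulR (L : Submodule ℤ A) (z : A) : Submodule ℤ A := L.map (LinearMap.mulRight ℤ z)

theorem mulL_mulL (x y : A) (J : Submodule ℤ A) : mulL x (mulL y J) = mulL (x * y) J := by
  rw [mulL, mulL, mulL, ← Submodule.map_comp, ← LinearMap.mulLeft_mul]

/-- The left order `{x ∈ A | x I ⊆ I}`. -/
def leftOrder (I : Submodule ℤ A) : Subalgebra ℤ A where
  carrier := {x | ∀ y ∈ I, x * y ∈ I}
  mul_mem' {a b} ha hb y hy := by
    rw [mul_assoc]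
    exact ha _ (hb _ hy)
  add_mem' {a b} ha hb y hy := by
    rw [add_mul]
    exact I.add_mem (ha _ hy) (hb _ hy)
  algebraMap_mem' r y hy := by
    rw [← Algebra.smul_def]
    exact I.smul_mem r hy

variable [Algebra ℚ A]

/-- An order of `A`: a unitary subring (that is, a `ℤ`-subalgebra) which is a `ℤ`-lattice, i.e. is
finitely generated over `ℤ` and generates `A` as a `ℚ`-vector space. -/
def IsOrder (O : Subalgebra ℤ A) : Prop :=
  Submodule.IsLattice ℚ (Subalgebra.toSubmodule O)

/-- A maximal order of `A`: an order not strictly contained in another order. -/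
def IsMaximalOrder (O : Subalgebra ℤ A) : Prop := Maximal IsOrder O

/-- A left fractional ideal of `O`: a `ℤ`-lattice of `A` whose left order is `O`. -/
structure IsLeftFractionalIdeal (O : Subalgebra ℤ A) (I : Submodule ℤ A) : Prop where
  isLattice : Submodule.IsLattice ℚ I
  leftOrder_eq : leftOrder I = O

open Classical in
/-- The norm `n(c I) / n(c)` of a left (or right) fractional ideal `I` of `O`, for any positive
integer `c` with `c I ⊆ O`. It does not depend on `c`: see `fractionalNorm_eq`. -/
noncomputable def fractionalNorm (φ : ℝ ⊗[ℚ] A ≃ₐ[ℝ] ℍ[ℝ]) (O : Subalgebra ℤ A)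
    (I : Submodule ℤ A) : ℝ :=
  if h : ∃ c : ℕ, 0 < c ∧ mulL (c : A) I ≤ Subalgebra.toSubmodule O then
    (idealNorm φ (mulL (h.choose : A) I) : ℝ) / reducedNorm φ (h.choose : A)
  else 0

end Lattices

section WellDefined

variable {A : Type*} [Ring A] [Algebra ℚ A]

theorem reducedNorm_natCast (φ : ℝ ⊗[ℚ] A ≃ₐ[ℝ] ℍ[ℝ]) (c : ℕ) :
    reducedNorm φ (c : A) = (c : ℝ) ^ 2 := by
  have h : (1 : ℝ) ⊗ₜ[ℚ] (c : A) = ((c : ℕ) : ℝ ⊗[ℚ] A) := by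
    exact map_natCast (Algebra.TensorProduct.includeRight : A →ₐ[ℚ] ℝ ⊗[ℚ] A) c
  rw [reducedNorm, h, map_natCast, Quaternion.normSq_natCast]

theorem reducedNorm_mul (φ : ℝ ⊗[ℚ] A ≃ₐ[ℝ] ℍ[ℝ]) (x y : A) :
    reducedNorm φ (x * y) = reducedNorm φ x * reducedNorm φ y := by
  have h : (1 : ℝ) ⊗ₜ[ℚ] (x * y) = (1 ⊗ₜ[ℚ] x) * (1 ⊗ₜ[ℚ] y) := by simp
  rw [reducedNorm, h, map_mul, map_mul]
  rfl

theorem finite_of_identification (φ : ℝ ⊗[ℚ] A ≃ₐ[ℝ] ℍ[ℝ]) : Module.Finite ℚ A := by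
  have : Module.Finite ℝ (ℝ ⊗[ℚ] A) := Module.Finite.equiv φ.symm.toLinearEquiv
  exact Module.Finite.of_finite_tensorProduct_of_faithfullyFlat ℝ

theorem exists_trace_det {O : Subalgebra ℤ A} (hO : IsOrder O) {x : A} (hx : x ∈ O) :
    ∃ t d : ℤ, LinearMap.trace ℚ A (LinearMap.mulLeft ℚ x) = t ∧
      LinearMap.det (LinearMap.mulLeft ℚ x) = d := by
  classical
  have : Submodule.IsLattice ℚ (Subalgebra.toSubmodule O) := hO
  have hfree : Module.Free ℤ (Subalgebra.toSubmodule O) := Submodule.IsLattice.free (K := ℚ) _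
  let b := Module.Free.chooseBasis ℤ (Subalgebra.toSubmodule O)
  let B := b.extendOfIsLattice ℚ
  let M : Matrix _ _ ℤ := fun i j =>
    b.repr ⟨x * (b j : A), O.mul_mem hx (b j).2⟩ i
  have hM : LinearMap.toMatrix B B (LinearMap.mulLeft ℚ x) = M.map (Int.castRingHom ℚ) := by
    ext i j
    have h1 : x * (b j : A) = ∑ i, ((M i j : ℤ) : ℚ) • B i := by
      have := congrArg Subtype.val
        (b.sum_repr ⟨x * (b j : A), O.mul_mem hx (b j).2⟩)
      simp only [Submodule.coe_sum, Submodule.coe_smul] at this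
      rw [← this]
      refine Finset.sum_congr rfl fun i _ => ?_
      simp only [B, Module.Basis.extendOfIsLattice_apply, M]
      rw [Int.cast_smul_eq_zsmul]
    rw [LinearMap.toMatrix_apply, LinearMap.mulLeft_apply,
      show B j = (b j : A) from Module.Basis.extendOfIsLattice_apply ℚ b j, h1,
      Module.Basis.repr_sum_self]
    simp
  refine ⟨M.trace, M.det, ?_, ?_⟩
  · rw [LinearMap.trace_eq_matrix_trace ℚ B, hM, Matrix.trace, Matrix.trace]
    simp
  · rw [← LinearMap.det_toMatrix B, hM]
    exact (RingHom.map_det (Int.castRingHom ℚ) M).symm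

theorem toMatrix_mulLeft (q : QuaternionAlgebra ℝ (-1) 0 (-1)) :
    LinearMap.toMatrix (QuaternionAlgebra.basisOneIJK (-1 : ℝ) 0 (-1))
      (QuaternionAlgebra.basisOneIJK (-1 : ℝ) 0 (-1)) (LinearMap.mulLeft ℝ q) =
      !![q.re, -q.imI, -q.imJ, -q.imK; q.imI, q.re, -q.imK, q.imJ;
        q.imJ, q.imK, q.re, -q.imI; q.imK, -q.imJ, q.imI, q.re] := by
  have hB : ∀ j : Fin 4, QuaternionAlgebra.basisOneIJK (-1 : ℝ) 0 (-1) j =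
      ⟨if j = 0 then 1 else 0, if j = 1 then 1 else 0, if j = 2 then 1 else 0,
        if j = 3 then 1 else 0⟩ := by
    intro j
    apply (QuaternionAlgebra.basisOneIJK (-1 : ℝ) 0 (-1)).repr.injective
    ext i
    rw [Module.Basis.repr_self, Finsupp.single_apply, QuaternionAlgebra.coe_basisOneIJK_repr]
    fin_cases i <;> simp
  ext i j
  rw [LinearMap.toMatrix_apply, LinearMap.mulLeft_apply, QuaternionAlgebra.coe_basisOneIJK_repr, hB]
  fin_cases i <;> fin_cases j <;> simp

theorem trace_mulLeft (q : ℍ[ℝ]) :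
    LinearMap.trace ℝ ℍ[ℝ] (LinearMap.mulLeft ℝ q) = 4 * q.re := by
  have h : ∀ p : QuaternionAlgebra ℝ (-1) 0 (-1),
      LinearMap.trace ℝ _ (LinearMap.mulLeft ℝ p) = 4 * p.re := by
    intro p
    rw [LinearMap.trace_eq_matrix_trace ℝ (QuaternionAlgebra.basisOneIJK (-1 : ℝ) 0 (-1)),
      toMatrix_mulLeft, Matrix.trace]
    simp [Fin.sum_univ_four]
    ring
  exact h q

theorem det_mulLeft (q : ℍ[ℝ]) :
    LinearMap.det (LinearMap.mulLeft ℝ q) = Quaternion.normSq q ^ 2 := by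
  have h : ∀ p : QuaternionAlgebra ℝ (-1) 0 (-1), LinearMap.det (LinearMap.mulLeft ℝ p) =
      (p.re ^ 2 + p.imI ^ 2 + p.imJ ^ 2 + p.imK ^ 2) ^ 2 := by
    intro p
    rw [← LinearMap.det_toMatrix (QuaternionAlgebra.basisOneIJK (-1 : ℝ) 0 (-1)),
      toMatrix_mulLeft, Matrix.det_succ_row_zero]
    simp [Fin.sum_univ_four, Matrix.det_fin_three, Fin.succAbove, Matrix.submatrix_apply]
    ring
  rw [Quaternion.normSq_def']
  exact h q

theorem mulLeft_identification (φ : ℝ ⊗[ℚ] A ≃ₐ[ℝ] ℍ[ℝ]) (x : A) :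
    LinearMap.mulLeft ℝ (φ (1 ⊗ₜ[ℚ] x)) =
      (φ.toLinearEquiv : _ →ₗ[ℝ] _) ∘ₗ (LinearMap.mulLeft ℚ x).baseChange ℝ ∘ₗ
        (φ.toLinearEquiv.symm : _ →ₗ[ℝ] _) := by
  have h : (LinearMap.mulLeft ℚ x).baseChange ℝ = LinearMap.mulLeft ℝ ((1 : ℝ) ⊗ₜ[ℚ] x) := by
    ext y
    simp
  rw [h]
  ext1 q
  simp

theorem reducedNorm_eq_int (φ : ℝ ⊗[ℚ] A ≃ₐ[ℝ] ℍ[ℝ]) {O : Subalgebra ℤ A} (hO : IsOrder O)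
    {x : A} (hx : x ∈ O) : ∃ k : ℤ, reducedNorm φ x = k := by
  have := finite_of_identification φ
  have htr : ∀ y ∈ O, ∃ t : ℤ, 4 * (φ (1 ⊗ₜ[ℚ] y)).re = t := by
    intro y hy
    obtain ⟨t, -, ht, -⟩ := exists_trace_det hO hy
    refine ⟨t, ?_⟩
    have hc := LinearMap.trace_conj' ((LinearMap.mulLeft ℚ y).baseChange ℝ) φ.toLinearEquiv
    rw [LinearMap.trace_baseChange, ht] at hc
    rw [← trace_mulLeft, mulLeft_identification]
    refine Eq.trans ?_ (hc.trans (by simp))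
    rfl
  obtain ⟨-, d, -, hd⟩ := exists_trace_det hO hx
  have hn : reducedNorm φ x ^ 2 = d := by
    rw [reducedNorm, ← det_mulLeft, mulLeft_identification, LinearMap.det_conj,
      LinearMap.det_baseChange, hd]
    simp
  obtain ⟨t, ht⟩ := htr x hx
  obtain ⟨s, hs⟩ := htr (x * x) (O.mul_mem hx hx)
  have h2 : (1 : ℝ) ⊗ₜ[ℚ] (x * x) = (1 ⊗ₜ[ℚ] x) * (1 ⊗ₜ[ℚ] x) := by simp
  rw [h2, map_mul] at hs
  have hq : reducedNorm φ x = (((t : ℚ) ^ 2 / 8 - (s : ℚ) / 4 : ℚ) : ℝ) := by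
    push_cast
    rw [← ht, ← hs, reducedNorm, Quaternion.normSq_def']
    simp
    ring
  set r : ℚ := (t : ℚ) ^ 2 / 8 - (s : ℚ) / 4
  rw [hq] at hn
  have hr : r ^ 2 = d := by exact_mod_cast hn
  have hint : IsIntegral ℤ r := by
    apply IsIntegral.of_pow (n := 2) (by norm_num)
    rw [hr]
    exact isIntegral_algebraMap (R := ℤ) (A := ℚ)
  obtain ⟨k, hk⟩ := IsIntegrallyClosed.isIntegral_iff.mp hint
  refine ⟨k, ?_⟩
  rw [hq, ← hk]
  simp

/-- For a set of integers, scaling by `e` scales the greatest common divisor. -/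
theorem sSup_divisors_scale (S : Set ℤ) (e : ℕ) :
    sSup {d : ℕ | ∀ s ∈ S, (d : ℤ) ∣ e * s} = e * sSup {d : ℕ | ∀ s ∈ S, (d : ℤ) ∣ s} := by
  have key : ∀ f : ℤ, {d : ℕ | ∀ s ∈ S, (d : ℤ) ∣ f * s} =
      {d : ℕ | d ∣ (f * Submodule.IsPrincipal.generator (Ideal.span S)).natAbs} := by
    intro f
    set g := Submodule.IsPrincipal.generator (Ideal.span S)
    have hg : Ideal.span {g} = Ideal.span S := Ideal.span_singleton_generator _
    ext d
    simp only [Set.mem_ofPred_eq, ← Int.natCast_dvd]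
    constructor
    · intro h
      have hgm : g ∈ Ideal.span S := hg ▸ Ideal.mem_span_singleton_self g
      refine Submodule.span_induction (p := fun y _ => (d : ℤ) ∣ f * y) ?_ ?_ ?_ ?_ hgm
      · exact h
      · simp
      · intro a b _ _ ha hb
        rw [mul_add]
        exact dvd_add ha hb
      · intro a b _ hb
        rw [smul_eq_mul, mul_left_comm]
        exact hb.mul_left a
    · intro h s hs
      have : s ∈ Ideal.span {g} := hg ▸ Ideal.subset_span hs
      exact h.trans (mul_dvd_mul_left f (Ideal.mem_span_singleton.mp this))
  have hsup : ∀ n : ℕ, sSup {d : ℕ | d ∣ n} = n := by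
    intro n
    rcases Nat.eq_zero_or_pos n with rfl | hn
    · simp
    · exact IsGreatest.csSup_eq ⟨dvd_rfl, fun d hd => Nat.le_of_dvd hn hd⟩
  have h1 := key 1
  simp only [one_mul] at h1
  rw [key, h1, hsup, hsup, Int.natAbs_mul, Int.natAbs_natCast]

theorem idealNorm_mulL (φ : ℝ ⊗[ℚ] A ≃ₐ[ℝ] ℍ[ℝ]) {O : Subalgebra ℤ A} (hO : IsOrder O)
    {J : Submodule ℤ A} (hJ : J ≤ Subalgebra.toSubmodule O) {c : ℕ} (hc : 0 < c) :
    idealNorm φ (mulL (c : A) J) = c ^ 2 * idealNorm φ J := by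
  have hc0 : ∀ x : A, x ≠ 0 → (c : A) * x ≠ 0 := by
    intro x hx h
    have h' : (c : ℚ) • x = 0 := by rw [Algebra.smul_def, map_natCast, h]
    rcases smul_eq_zero.mp h' with h' | h'
    · exact hc.ne' (by exact_mod_cast h')
    · exact hx h'
  let S : Set ℤ := {k | ∃ x ∈ J, x ≠ 0 ∧ reducedNorm φ x = k}
  have h1 : idealNorm φ J = sSup {d : ℕ | ∀ s ∈ S, (d : ℤ) ∣ s} := by
    rw [idealNorm]
    congr 1
    ext d
    constructor
    · rintro h s ⟨x, hx, hx0, hs⟩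
      obtain ⟨k, hk⟩ := h x hx hx0
      exact ⟨k, by exact_mod_cast hs.symm.trans hk⟩
    · intro h x hx hx0
      obtain ⟨m, hm⟩ := reducedNorm_eq_int φ hO (hJ hx)
      obtain ⟨k, hk⟩ := h m ⟨x, hx, hx0, hm⟩
      exact ⟨k, by rw [hm, hk]; push_cast; rfl⟩
  have h2 : idealNorm φ (mulL (c : A) J) = sSup {d : ℕ | ∀ s ∈ S, (d : ℤ) ∣ (c ^ 2 : ℕ) * s} := by
    rw [idealNorm]
    congr 1
    ext d
    constructor
    · rintro h s ⟨x, hx, hx0, hs⟩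
      obtain ⟨k, hk⟩ := h ((c : A) * x) ⟨x, hx, rfl⟩ (hc0 x hx0)
      rw [reducedNorm_mul, reducedNorm_natCast, hs] at hk
      exact ⟨k, by exact_mod_cast hk⟩
    · rintro h _ ⟨x, hx, rfl⟩ hx0
      obtain ⟨m, hm⟩ := reducedNorm_eq_int φ hO (hJ hx)
      have hx1 : x ≠ 0 := by
        rintro rfl
        exact hx0 (by simp)
      obtain ⟨k, hk⟩ := h m ⟨x, hx, hx1, hm⟩
      refine ⟨k, ?_⟩
      rw [LinearMap.mulLeft_apply, reducedNorm_mul, reducedNorm_natCast, hm]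
      exact_mod_cast hk
  rw [h1, h2, sSup_divisors_scale S (c ^ 2)]

/-- The norm of a fractional ideal does not depend on the chosen denominator. -/
theorem fractionalNorm_eq (φ : ℝ ⊗[ℚ] A ≃ₐ[ℝ] ℍ[ℝ]) {O : Subalgebra ℤ A} (hO : IsOrder O)
    {I : Submodule ℤ A} {c : ℕ} (hc : 0 < c) (hI : mulL (c : A) I ≤ Subalgebra.toSubmodule O) :
    fractionalNorm φ O I = (idealNorm φ (mulL (c : A) I) : ℝ) / reducedNorm φ (c : A) := by
  have h : ∃ c : ℕ, 0 < c ∧ mulL (c : A) I ≤ Subalgebra.toSubmodule O := ⟨c, hc, hI⟩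
  rw [fractionalNorm, dif_pos h]
  obtain ⟨he, hJ⟩ := h.choose_spec
  set e := h.choose
  have h1 := idealNorm_mulL φ hO hJ hc
  have h2 := idealNorm_mulL φ hO hI he
  rw [mulL_mulL] at h1 h2
  rw [(Nat.cast_commute c (e : A)).eq, h2] at h1
  have h3 : (e : ℝ) ^ 2 * idealNorm φ (mulL (c : A) I) = c ^ 2 * idealNorm φ (mulL (e : A) I) := by
    exact_mod_cast h1
  have hc' : (c : ℝ) ≠ 0 := by positivity
  have he' : (e : ℝ) ≠ 0 := by positivity
  rw [reducedNorm_natCast, reducedNorm_natCast]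
  field_simp
  linarith

end WellDefined

end DefiniteQuaternion

/-! Put `P = O ∩ zO`, so that `Λ = P ∩ Pz` and `[O:Λ] = [O:P]·[P : P ∩ Pz]`. Choose `c > 0` such
that the left ideal `J = c(Oz⁻¹ + O)` lies in `O`, and let `g` be its norm, so that `n(Oz⁻¹ + O) =
g/c²`. Both factors turn out to equal `c⁴/g²`, whence `[O:Λ] = c⁸/g⁴`.

The engine is that left ideals of a maximal order are locally principal, used without localizing.
For each prime `p` some `x ∈ J` has norm `g·N` with `p ∤ N`, and then `N·J ⊆ Ox ⊆ J`
(`smul_mem_mulR`); maximality enters through `mem_of_maximal`. Hence `[O:J] = g²`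
(`idx_eq_idealNorm_sq`). Dually, `xP ⊆ cO` with `cO/xP` killed by `N`. Comparing `[O:xP]` along two
chains gives `[O:P]·g² = c⁴` (`idx_infMulL_mul`). Right multiplication by `z` commutes with left
multiplication by `x`, so also `[P : P ∩ Pz] = [O : O ∩ Oz]` (`idx_mulR_infMulL`). This last index
is `[Oz⁻¹ + O : O] = c⁴/[O:J] = c⁴/g²`. Each identity is checked one prime at a time by
`eq_of_forall_prime`. -/

namespace DefiniteQuaternion

/-! ### Reduced trace, reduced norm and canonical involution over `ℚ` -/

section TraceNorm

variable {A : Type*} [Ring A] [Algebra ℚ A]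

/-- The reduced trace, as half of the trace of the left multiplication. -/
noncomputable def trd : A →ₗ[ℚ] ℚ :=
  (1 / 2 : ℚ) • (LinearMap.trace ℚ A ∘ₗ LinearMap.mul ℚ A)

/-- The rational reduced norm. -/
noncomputable def nrd (x : A) : ℚ := (trd x ^ 2 - trd (x * x)) / 2

/-- The canonical involution. -/
noncomputable def conj : A →ₗ[ℚ] A :=
  (Algebra.linearMap ℚ A) ∘ₗ trd - LinearMap.id

/-- The embedding of `A` in Hamilton's quaternions. -/
noncomputable def toHamilton (φ : ℝ ⊗[ℚ] A ≃ₐ[ℝ] ℍ[ℝ]) : A →ₐ[ℚ] ℍ[ℝ] :=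
  (φ.toAlgHom.restrictScalars ℚ).comp Algebra.TensorProduct.includeRight

theorem toHamilton_injective (φ : ℝ ⊗[ℚ] A ≃ₐ[ℝ] ℍ[ℝ]) :
    Function.Injective (toHamilton φ) :=
  φ.injective.comp (Algebra.TensorProduct.includeRight_injective (algebraMap ℚ ℝ).injective)

theorem conj_apply (x : A) : conj x = algebraMap ℚ A (trd x) - x := rfl

theorem toHamilton_algebraMap (φ : ℝ ⊗[ℚ] A ≃ₐ[ℝ] ℍ[ℝ]) (r : ℚ) :
    toHamilton φ (algebraMap ℚ A r) = ((r : ℝ) : ℍ[ℝ]) := by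
  rw [AlgHom.commutes]
  rfl

/-- Left multiplication by `q` on `ℍ` has trace `4 Re q`, and traces survive base change and
conjugation by `φ`; this accounts for the factor `1/2` in `trd`. -/
theorem trd_cast (φ : ℝ ⊗[ℚ] A ≃ₐ[ℝ] ℍ[ℝ]) (x : A) :
    (trd x : ℝ) = 2 * (toHamilton φ x).re := by
  have := finite_of_identification φ
  have hc := LinearMap.trace_conj' ((LinearMap.mulLeft ℚ x).baseChange ℝ) φ.toLinearEquiv
  rw [LinearMap.trace_baseChange] at hc
  have h4 : 4 * (toHamilton φ x).re =
      algebraMap ℚ ℝ (LinearMap.trace ℚ A (LinearMap.mulLeft ℚ x)) := by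
    rw [← trace_mulLeft]
    refine Eq.trans ?_ hc
    change LinearMap.trace ℝ ℍ[ℝ] (LinearMap.mulLeft ℝ (φ (1 ⊗ₜ[ℚ] x))) = _
    rw [mulLeft_identification]
    rfl
  have h2 : trd x = 1 / 2 * LinearMap.trace ℚ A (LinearMap.mulLeft ℚ x) := rfl
  rw [h2]
  simp only [eq_ratCast] at h4
  push_cast
  linarith

theorem reducedNorm_eq_nrd (φ : ℝ ⊗[ℚ] A ≃ₐ[ℝ] ℍ[ℝ]) (x : A) :
    reducedNorm φ x = nrd x := by
  rw [nrd]
  push_cast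
  rw [trd_cast φ, trd_cast φ, map_mul]
  change Quaternion.normSq (toHamilton φ x) = _
  rw [Quaternion.normSq_def']
  simp
  ring

theorem toHamilton_conj (φ : ℝ ⊗[ℚ] A ≃ₐ[ℝ] ℍ[ℝ]) (x : A) :
    toHamilton φ (conj x) = star (toHamilton φ x) := by
  rw [conj_apply, map_sub, toHamilton_algebraMap, trd_cast φ]
  ext <;> simp
  ring

theorem mul_conj (φ : ℝ ⊗[ℚ] A ≃ₐ[ℝ] ℍ[ℝ]) (x : A) :
    x * conj x = algebraMap ℚ A (nrd x) := by
  apply toHamilton_injective φ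
  rw [map_mul, toHamilton_conj, toHamilton_algebraMap, ← reducedNorm_eq_nrd φ,
    Quaternion.self_mul_star]
  rfl

theorem conj_mul (φ : ℝ ⊗[ℚ] A ≃ₐ[ℝ] ℍ[ℝ]) (x y : A) : conj (x * y) = conj y * conj x := by
  apply toHamilton_injective φ
  simp [toHamilton_conj]

theorem conj_conj (φ : ℝ ⊗[ℚ] A ≃ₐ[ℝ] ℍ[ℝ]) (x : A) : conj (conj x) = x := by
  apply toHamilton_injective φ
  simp [toHamilton_conj]

theorem nrd_conj (φ : ℝ ⊗[ℚ] A ≃ₐ[ℝ] ℍ[ℝ]) (x : A) : nrd (conj x) = nrd x := by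
  have : reducedNorm φ (conj x) = reducedNorm φ x := by
    change Quaternion.normSq (toHamilton φ _) = Quaternion.normSq (toHamilton φ _)
    rw [toHamilton_conj, Quaternion.normSq_star]
  rw [reducedNorm_eq_nrd, reducedNorm_eq_nrd] at this
  exact_mod_cast this

theorem conj_mul_self (φ : ℝ ⊗[ℚ] A ≃ₐ[ℝ] ℍ[ℝ]) (x : A) :
    conj x * x = algebraMap ℚ A (nrd x) := by
  have := mul_conj φ (conj x)
  rwa [conj_conj φ, nrd_conj φ] at this

theorem trd_mul_comm (φ : ℝ ⊗[ℚ] A ≃ₐ[ℝ] ℍ[ℝ]) (x y : A) : trd (x * y) = trd (y * x) := by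
  have : (trd (x * y) : ℝ) = trd (y * x) := by
    rw [trd_cast φ, trd_cast φ, map_mul, map_mul]
    simp
    ring
  exact_mod_cast this

theorem nrd_add (φ : ℝ ⊗[ℚ] A ≃ₐ[ℝ] ℍ[ℝ]) (x y : A) :
    nrd (x + y) = nrd x + nrd y + trd (x * conj y) := by
  have : (nrd (x + y) : ℝ) = nrd x + nrd y + trd (x * conj y) := by
    rw [← reducedNorm_eq_nrd φ, ← reducedNorm_eq_nrd φ, ← reducedNorm_eq_nrd φ, trd_cast φ,
      map_mul, toHamilton_conj]
    change Quaternion.normSq (toHamilton φ _) =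
      Quaternion.normSq (toHamilton φ _) + Quaternion.normSq (toHamilton φ _) + _
    rw [map_add, Quaternion.normSq_def', Quaternion.normSq_def', Quaternion.normSq_def']
    simp
    ring
  exact_mod_cast this

theorem nrd_mul (φ : ℝ ⊗[ℚ] A ≃ₐ[ℝ] ℍ[ℝ]) (x y : A) : nrd (x * y) = nrd x * nrd y := by
  have := reducedNorm_mul φ x y
  simp only [reducedNorm_eq_nrd] at this
  exact_mod_cast this

theorem nrd_algebraMap (φ : ℝ ⊗[ℚ] A ≃ₐ[ℝ] ℍ[ℝ]) (r : ℚ) :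
    nrd (algebraMap ℚ A r) = r ^ 2 := by
  have : (nrd (algebraMap ℚ A r) : ℝ) = (r : ℝ) ^ 2 := by
    rw [← reducedNorm_eq_nrd φ]
    change Quaternion.normSq (toHamilton φ _) = _
    rw [toHamilton_algebraMap, Quaternion.normSq_coe]
  exact_mod_cast this

theorem nrd_smul (φ : ℝ ⊗[ℚ] A ≃ₐ[ℝ] ℍ[ℝ]) (r : ℚ) (x : A) :
    nrd (r • x) = r ^ 2 * nrd x := by
  rw [Algebra.smul_def, nrd_mul φ, nrd_algebraMap φ]

theorem nrd_natCast (φ : ℝ ⊗[ℚ] A ≃ₐ[ℝ] ℍ[ℝ]) (n : ℕ) : nrd (n : A) = n ^ 2 := by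
  rw [← map_natCast (algebraMap ℚ A), nrd_algebraMap φ]

theorem nrd_one (φ : ℝ ⊗[ℚ] A ≃ₐ[ℝ] ℍ[ℝ]) : nrd (1 : A) = 1 := by
  simpa using nrd_natCast φ 1

theorem nrd_pos (φ : ℝ ⊗[ℚ] A ≃ₐ[ℝ] ℍ[ℝ]) {x : A} (hx : x ≠ 0) : 0 < nrd x := by
  have h : 0 < reducedNorm φ x := by
    change 0 < Quaternion.normSq (toHamilton φ x)
    refine lt_of_le_of_ne Quaternion.normSq_nonneg fun h => hx ?_
    rw [eq_comm, Quaternion.normSq_eq_zero] at h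
    exact toHamilton_injective φ (by rw [h, map_zero])
  rw [reducedNorm_eq_nrd] at h
  exact_mod_cast h

theorem isUnit_of_ne_zero (φ : ℝ ⊗[ℚ] A ≃ₐ[ℝ] ℍ[ℝ]) {x : A} (hx : x ≠ 0) : IsUnit x := by
  have h := (nrd_pos φ hx).ne'
  refine isUnit_iff_exists.mpr ⟨(nrd x)⁻¹ • conj x, ?_, ?_⟩
  · rw [mul_smul_comm, mul_conj φ, ← Algebra.smul_def _ (1 : A) |>.trans (mul_one _), smul_smul,
      inv_mul_cancel₀ h, one_smul]
  · rw [smul_mul_assoc, conj_mul_self φ, ← Algebra.smul_def _ (1 : A) |>.trans (mul_one _),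
      smul_smul, inv_mul_cancel₀ h, one_smul]

theorem trd_conj (φ : ℝ ⊗[ℚ] A ≃ₐ[ℝ] ℍ[ℝ]) (x : A) : trd (conj x) = trd x := by
  have : (trd (conj x) : ℝ) = trd x := by
    rw [trd_cast φ, trd_cast φ, toHamilton_conj]; simp
  exact_mod_cast this

theorem nrd_int (φ : ℝ ⊗[ℚ] A ≃ₐ[ℝ] ℍ[ℝ]) {O : Subalgebra ℤ A} (hO : IsOrder O)
    {x : A} (hx : x ∈ O) : ∃ k : ℤ, nrd x = k := by
  obtain ⟨k, hk⟩ := reducedNorm_eq_int φ hO hx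
  rw [reducedNorm_eq_nrd] at hk
  exact ⟨k, by exact_mod_cast hk⟩

/-- Polarization: the trace of `x` is `n(1 + x) - n(x) - 1`, and norms on an order are integers. -/
theorem trd_int (φ : ℝ ⊗[ℚ] A ≃ₐ[ℝ] ℍ[ℝ]) {O : Subalgebra ℤ A} (hO : IsOrder O)
    {x : A} (hx : x ∈ O) : ∃ k : ℤ, trd x = k := by
  obtain ⟨k, hk⟩ := nrd_int φ hO hx
  obtain ⟨l, hl⟩ := nrd_int φ hO (O.add_mem O.one_mem hx)
  refine ⟨l - k - 1, ?_⟩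
  rw [nrd_add φ, one_mul, trd_conj φ, nrd_one φ] at hl
  push_cast
  linarith

theorem conj_mem (φ : ℝ ⊗[ℚ] A ≃ₐ[ℝ] ℍ[ℝ]) {O : Subalgebra ℤ A} (hO : IsOrder O)
    {x : A} (hx : x ∈ O) : conj x ∈ O := by
  obtain ⟨k, hk⟩ := trd_int φ hO hx
  rw [conj_apply, hk, map_intCast]
  exact O.sub_mem (intCast_mem O k) hx

/-- An element pairing integrally with a maximal order, and of integral norm, lies in it. -/
theorem mem_of_maximal (φ : ℝ ⊗[ℚ] A ≃ₐ[ℝ] ℍ[ℝ]) {O : Subalgebra ℤ A} (hO : IsMaximalOrder O)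
    {w : A} (hn : ∃ k : ℤ, nrd w = k) (ht : ∀ a ∈ O, ∃ k : ℤ, trd (a * w) = k) : w ∈ O := by
  obtain ⟨n, hn⟩ := hn
  obtain ⟨s, hs⟩ := ht 1 O.one_mem
  rw [one_mul] at hs
  -- The involution reverses products: `tr(wa) - wa = conj a * (tr w - w)`, which moves `w` to the
  -- right of elements of `O`.
  have hcomm : ∀ a ∈ O, ∃ u ∈ O, ∃ v ∈ O, w * a = u + v * w := by
    intro a ha
    obtain ⟨t, h⟩ := ht a ha
    have h1 : conj (w * a) = conj a * conj w := conj_mul φ w a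
    rw [conj_apply (w * a), trd_mul_comm φ, h, conj_apply w, hs, map_intCast, map_intCast,
      mul_sub] at h1
    refine ⟨(t : A) - conj a * (s : A), O.sub_mem (intCast_mem O t)
      (O.mul_mem (conj_mem φ hO.prop ha) (intCast_mem O s)), conj a, conj_mem φ hO.prop ha, ?_⟩
    rw [← sub_eq_iff_eq_add', ← sub_eq_zero]
    rw [← sub_eq_zero] at h1
    rw [← neg_eq_zero, ← h1]
    abel
  have hsq : ∃ u ∈ O, ∃ v ∈ O, w * w = u + v * w := by
    refine ⟨-(n : A), O.neg_mem (intCast_mem O n), (s : A), intCast_mem O s, ?_⟩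
    have h1 := conj_mul_self φ w
    rw [conj_apply, hs, hn, map_intCast, map_intCast, sub_mul] at h1
    rw [← h1]
    abel
  -- By `hcomm` and the quadratic equation of `w`, `O + Ow` is closed under multiplication. It is
  -- thus an order containing `O`, and maximality forces `w ∈ O`.
  let R : Subalgebra ℤ A :=
    { carrier := {x | ∃ a ∈ O, ∃ b ∈ O, x = a + b * w}
      mul_mem' := by
        rintro _ _ ⟨a, ha, b, hb, rfl⟩ ⟨c, hc, d, hd, rfl⟩
        obtain ⟨u, hu, v, hv, e1⟩ := hcomm c hc
        obtain ⟨u', hu', v', hv', e2⟩ := hcomm d hd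
        obtain ⟨u'', hu'', v'', hv'', e3⟩ := hsq
        refine ⟨a * c + b * u + b * v' * u'',
          O.add_mem (O.add_mem (O.mul_mem ha hc) (O.mul_mem hb hu))
            (O.mul_mem (O.mul_mem hb hv') hu''),
          a * d + b * v + b * u' + b * v' * v'',
          O.add_mem (O.add_mem (O.add_mem (O.mul_mem ha hd) (O.mul_mem hb hv))
            (O.mul_mem hb hu')) (O.mul_mem (O.mul_mem hb hv') hv''), ?_⟩
        calc (a + b * w) * (c + d * w)
            = a * c + a * d * w + b * (w * c) + b * (w * d) * w := by noncomm_ring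
          _ = a * c + a * d * w + b * (u + v * w) + b * (u' * w + v' * (w * w)) := by
              rw [e1, e2]; noncomm_ring
          _ = _ := by rw [e3]; noncomm_ring
      add_mem' := by
        rintro _ _ ⟨a, ha, b, hb, rfl⟩ ⟨c, hc, d, hd, rfl⟩
        exact ⟨a + c, O.add_mem ha hc, b + d, O.add_mem hb hd, by noncomm_ring⟩
      algebraMap_mem' := fun r => ⟨_, O.algebraMap_mem r, 0, O.zero_mem, by simp⟩ }
  have hOR : O ≤ R := fun a ha => ⟨a, ha, 0, O.zero_mem, by simp⟩
  have hlat : Submodule.IsLattice ℚ (Subalgebra.toSubmodule O) := hO.prop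
  have hR : IsOrder R := by
    refine Submodule.IsLattice.of_le_of_isLattice_of_fg ℚ
      (M := Subalgebra.toSubmodule O) hOR ?_
    have : Subalgebra.toSubmodule R =
        Subalgebra.toSubmodule O ⊔ mulR (Subalgebra.toSubmodule O) w := by
      ext x
      rw [Submodule.mem_sup]
      constructor
      · rintro ⟨a, ha, b, hb, rfl⟩
        exact ⟨a, ha, _, ⟨b, hb, rfl⟩, rfl⟩
      · rintro ⟨a, ha, _, ⟨b, hb, rfl⟩, rfl⟩
        exact ⟨a, ha, b, hb, rfl⟩
    rw [this]
    exact hlat.fg.sup (hlat.fg.map _)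
  have : R ≤ O := hO.2 hR hOR
  exact this ⟨0, O.zero_mem, 1, O.one_mem, by simp⟩

end TraceNorm

/-! ### Indices of lattices, compared prime by prime -/

section LatticeIndex

/-- The index `[L : L ∩ M]` of `M` in `L`. -/
noncomputable def idx {A : Type*} [AddCommGroup A] (M L : Submodule ℤ A) : ℕ :=
  M.toAddSubgroup.relIndex L.toAddSubgroup

section AddCommGroup

variable {A : Type*} [AddCommGroup A]

theorem idx_mul_idx {M L K : Submodule ℤ A} (h₁ : M ≤ L) (h₂ : L ≤ K) :
    idx M L * idx L K = idx M K :=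
  AddSubgroup.relIndex_mul_relIndex M.toAddSubgroup L.toAddSubgroup K.toAddSubgroup
    (Submodule.toAddSubgroup_mono h₁) (Submodule.toAddSubgroup_mono h₂)

theorem idx_map {f : A →ₗ[ℤ] A} (hf : Function.Injective f) (M L : Submodule ℤ A) :
    idx (M.map f) (L.map f) = idx M L := by
  unfold idx
  rw [Submodule.map_toAddSubgroup, Submodule.map_toAddSubgroup,
    AddSubgroup.relIndex_map_map_of_injective _ _ hf]

theorem idx_inf_left (M L : Submodule ℤ A) : idx (M ⊓ L) L = idx M L :=
  AddSubgroup.inf_relIndex_right M.toAddSubgroup L.toAddSubgroup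

theorem idx_sup_right (M L : Submodule ℤ A) : idx M (L ⊔ M) = idx M L := by
  rw [idx, idx, Submodule.sup_toAddSubgroup, AddSubgroup.relIndex_sup_right]

/-- The quotient is finitely generated and killed by `N`, hence finite; by Cauchy, `p` dividing its
order would give an element of order `p`, forcing `p ∣ N`. -/
theorem not_dvd_idx {M L : Submodule ℤ A} (hL : L.FG) {N p : ℕ} (hp : p.Prime) (hN : ¬ p ∣ N)
    (h : ∀ x ∈ L, (N : ℤ) • x ∈ M) : ¬ p ∣ idx M L := by
  have hN0 : (N : ℤ) ≠ 0 := by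
    rintro h0
    exact hN (by simp [Int.natCast_eq_zero.mp h0])
  let Q := L ⧸ M.submoduleOf L
  have hkill : ∀ q : Q, (N : ℤ) • q = 0 := by
    intro q
    obtain ⟨x, rfl⟩ := Submodule.Quotient.mk_surjective _ q
    rw [← Submodule.Quotient.mk_smul, Submodule.Quotient.mk_eq_zero]
    exact h x x.2
  have : Module.Finite ℤ L := Module.Finite.iff_fg.mpr hL
  have hfin : Finite Q := Module.finite_of_fg_torsion Q fun q =>
    ⟨⟨(N : ℤ), mem_nonZeroDivisors_of_ne_zero hN0⟩, hkill q⟩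
  have hcard : idx M L = Nat.card Q := rfl
  have : Fintype Q := Fintype.ofFinite Q
  have : Fact p.Prime := ⟨hp⟩
  rw [hcard, Nat.card_eq_fintype_card]
  intro hdvd
  obtain ⟨q, hq⟩ := exists_prime_addOrderOf_dvd_card p hdvd
  apply hN
  rw [← hq]
  exact addOrderOf_dvd_of_nsmul_eq_zero (by simpa using hkill q)

theorem eq_of_forall_prime {k l : ℕ}
    (h : ∀ p : ℕ, p.Prime → ∃ u v, ¬ p ∣ u ∧ ¬ p ∣ v ∧ k * u = l * v) : k = l := by
  have ne : ∀ {p u : ℕ}, ¬ p ∣ u → u ≠ 0 := fun hu h0 => hu (h0 ▸ dvd_zero _)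
  rcases Nat.eq_zero_or_pos k with rfl | hk
  · obtain ⟨u, v, -, hv, e⟩ := h 2 Nat.prime_two
    rw [zero_mul, eq_comm, Nat.mul_eq_zero] at e
    exact (e.resolve_right (ne hv)).symm
  rcases Nat.eq_zero_or_pos l with rfl | hl
  · obtain ⟨u, v, hu, -, e⟩ := h 2 Nat.prime_two
    rw [zero_mul, Nat.mul_eq_zero] at e
    exact e.resolve_right (ne hu)
  refine Nat.eq_of_factorization_eq hk.ne' hl.ne' fun p => ?_
  by_cases hp : p.Prime
  · obtain ⟨u, v, hu, hv, e⟩ := h p hp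
    have := congrArg (fun n => n.factorization p) e
    simpa [Nat.factorization_mul hk.ne' (ne hu), Nat.factorization_mul hl.ne' (ne hv),
      Nat.factorization_eq_zero_of_not_dvd hu, Nat.factorization_eq_zero_of_not_dvd hv] using this
  · rw [Nat.factorization_eq_zero_of_not_prime _ hp, Nat.factorization_eq_zero_of_not_prime _ hp]

end AddCommGroup

section Translates

variable {A : Type*} [Ring A]

theorem idx_mulL {x : A} (hx : IsUnit x) (M L : Submodule ℤ A) :
    idx (mulL x M) (mulL x L) = idx M L :=
  idx_map (fun _ _ h => hx.mul_left_cancel h) M L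

theorem idx_mulR {x : A} (hx : IsUnit x) (M L : Submodule ℤ A) :
    idx (mulR M x) (mulR L x) = idx M L :=
  idx_map (fun _ _ h => hx.mul_right_cancel h) M L

variable [Algebra ℚ A]

theorem det_mulLeft_eq (φ : ℝ ⊗[ℚ] A ≃ₐ[ℝ] ℍ[ℝ]) (x : A) :
    LinearMap.det (LinearMap.mulLeft ℚ x) = nrd x ^ 2 := by
  have := finite_of_identification φ
  have h : reducedNorm φ x ^ 2 = ((LinearMap.det (LinearMap.mulLeft ℚ x) : ℚ) : ℝ) := by
    rw [reducedNorm, ← det_mulLeft, mulLeft_identification, LinearMap.det_conj,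
      LinearMap.det_baseChange]
    simp
  rw [reducedNorm_eq_nrd] at h
  exact_mod_cast h.symm

/-- The index is the absolute value of the determinant of left multiplication, which is the square
of the reduced norm. -/
theorem idx_mulL_self (φ : ℝ ⊗[ℚ] A ≃ₐ[ℝ] ℍ[ℝ]) {L : Submodule ℤ A}
    [hL : Submodule.IsLattice ℚ L] {x : A} (hx : IsUnit x) (h : mulL x L ≤ L) :
    (idx (mulL x L) L : ℚ) = nrd x ^ 2 := by
  classical
  have hfree : Module.Free ℤ L := Submodule.IsLattice.free (K := ℚ) _
  let b := Module.Free.chooseBasis ℤ L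
  let B := b.extendOfIsLattice ℚ
  have hb : ∀ i, B i = (b i : A) := Module.Basis.extendOfIsLattice_apply ℚ b
  let e : A ≃ₗ[ℚ] A := LinearEquiv.ofBijective (LinearMap.mulLeft ℚ x)
    ⟨fun _ _ h => hx.mul_left_cancel h, fun y => by
      obtain ⟨u, rfl⟩ := hx
      exact ⟨u⁻¹ * y, by simp⟩⟩
  have hspan : L = Submodule.span ℤ (Set.range B) := by
    have h1 := congrArg (Submodule.map L.subtype) b.span_eq
    rw [Submodule.map_span, Submodule.map_subtype_top, ← Set.range_comp] at h1
    refine h1.symm.trans ?_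
    congr 2
    ext1 i
    exact (hb i).symm
  have h2 : L.toAddSubgroup = AddSubgroup.closure (Set.range B) := by
    conv_lhs => rw [hspan]
    rw [Submodule.span_int_eq_addSubgroupClosure]
  have h1 : (mulL x L).toAddSubgroup = AddSubgroup.closure (Set.range (B.map e)) := by
    conv_lhs => rw [mulL, hspan, Submodule.map_span, Submodule.span_int_eq_addSubgroupClosure,
      ← Set.range_comp]
    rfl
  rw [idx, AddSubgroup.relIndex_eq_abs_det _ _ h _ _ h1 h2]
  have h3 : ⇑(B.map e) = LinearMap.mulLeft ℚ x ∘ B := by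
    ext i
    rfl
  rw [h3, Module.Basis.det_comp, Module.Basis.det_self, mul_one, det_mulLeft_eq φ,
    abs_of_nonneg (sq_nonneg _)]

theorem conj_injective (φ : ℝ ⊗[ℚ] A ≃ₐ[ℝ] ℍ[ℝ]) : Function.Injective (conj : A → A) :=
  Function.LeftInverse.injective (conj_conj φ)

/-- The involution preserves `O` and carries `Ox` to `conj x * O`, reducing to left multiplication.
-/
theorem idx_mulR_self (φ : ℝ ⊗[ℚ] A ≃ₐ[ℝ] ℍ[ℝ]) {O : Subalgebra ℤ A} (hO : IsOrder O) {x : A}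
    (hx : x ∈ O) (hx0 : x ≠ 0) :
    (idx (mulR (Subalgebra.toSubmodule O) x) (Subalgebra.toSubmodule O) : ℚ) = nrd x ^ 2 := by
  have hlat : Submodule.IsLattice ℚ (Subalgebra.toSubmodule O) := hO
  have hO' : (Subalgebra.toSubmodule O).map (conj.restrictScalars ℤ) =
      Subalgebra.toSubmodule O := by
    ext y
    constructor
    · rintro ⟨y, hy, rfl⟩
      exact conj_mem φ hO hy
    · intro hy
      exact ⟨conj y, conj_mem φ hO hy, conj_conj φ y⟩
  have hx' : (mulR (Subalgebra.toSubmodule O) x).map (conj.restrictScalars ℤ) =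
      mulL (conj x) (Subalgebra.toSubmodule O) := by
    ext y
    constructor
    · rintro ⟨_, ⟨y, hy, rfl⟩, rfl⟩
      exact ⟨conj y, conj_mem φ hO hy, (conj_mul φ y x).symm⟩
    · rintro ⟨y, hy, rfl⟩
      refine ⟨_, ⟨conj y, conj_mem φ hO hy, rfl⟩, ?_⟩
      change conj (conj y * x) = conj x * y
      rw [conj_mul φ, conj_conj φ]
  rw [← idx_map (f := conj.restrictScalars ℤ) (conj_injective φ), hO', hx', ← nrd_conj φ x]
  have hc : conj x ∈ O := conj_mem φ hO hx
  refine idx_mulL_self φ (isUnit_of_ne_zero φ fun h0 => hx0 ?_) ?_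
  · exact conj_injective φ (by rw [h0, map_zero])
  · rintro _ ⟨y, hy, rfl⟩
    exact O.mul_mem hc hy

end Translates

end LatticeIndex

/-! ### Ideal norms and local generators -/

section IdealNorm

variable {A : Type*} [Ring A] [Algebra ℚ A]

theorem exists_natCast_mul_mem {O : Subalgebra ℤ A} (hO : IsOrder O) (x : A) :
    ∃ m : ℕ, 0 < m ∧ (m : A) * x ∈ O := by
  have hlat : Submodule.IsLattice ℚ (Subalgebra.toSubmodule O) := hO
  have hx : x ∈ Submodule.span ℚ (Subalgebra.toSubmodule O : Set A) := by
    rw [hlat.span_eq_top]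
    trivial
  induction hx using Submodule.span_induction with
  | mem x h => exact ⟨1, one_pos, by simpa using h⟩
  | zero => exact ⟨1, one_pos, by simp⟩
  | add x y _ _ hx hy =>
    obtain ⟨m, hm, hx⟩ := hx
    obtain ⟨n, hn, hy⟩ := hy
    refine ⟨m * n, Nat.mul_pos hm hn, ?_⟩
    have : ((m * n : ℕ) : A) * (x + y) = n * (m * x) + m * (n * y) := by
      rw [← mul_assoc, ← mul_assoc, mul_add, ← Nat.cast_mul, ← Nat.cast_mul, Nat.mul_comm n m]
    rw [this]
    exact O.add_mem (O.mul_mem (natCast_mem O n) hx) (O.mul_mem (natCast_mem O m) hy)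
  | smul r x _ hx =>
    obtain ⟨m, hm, hx⟩ := hx
    refine ⟨r.den * m, Nat.mul_pos r.den_pos hm, ?_⟩
    have h1 : (r.den : A) * algebraMap ℚ A r = (r.num : A) := by
      rw [← map_natCast (algebraMap ℚ A), ← map_mul, Rat.den_mul_eq_num, map_intCast]
    have : ((r.den * m : ℕ) : A) * (r • x) = r.num * (m * x) := by
      rw [Nat.cast_mul, Algebra.smul_def, ← h1, (Nat.cast_commute r.den (m : A)).eq, mul_assoc,
        ← mul_assoc (r.den : A), h1, ← mul_assoc, ← mul_assoc, (Nat.cast_commute m (r.num : A)).eq]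
    rw [this]
    exact O.mul_mem (intCast_mem O _) hx

theorem nrd_nat (φ : ℝ ⊗[ℚ] A ≃ₐ[ℝ] ℍ[ℝ]) {O : Subalgebra ℤ A} (hO : IsOrder O) {x : A}
    (hx : x ∈ O) : ∃ k : ℕ, nrd x = k := by
  obtain ⟨k, hk⟩ := nrd_int φ hO hx
  have h0 : 0 ≤ nrd x := by
    rcases eq_or_ne x 0 with rfl | h
    · simp [nrd]
    · exact (nrd_pos φ h).le
  rw [hk] at h0
  lift k to ℕ using by exact_mod_cast h0
  exact ⟨k, by simpa using hk⟩

variable (φ : ℝ ⊗[ℚ] A ≃ₐ[ℝ] ℍ[ℝ]) {O : Subalgebra ℤ A}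

/-- The ideal norm divides all reduced norms and at each prime it is attained up to a unit. -/
theorem idealNorm_spec (hO : IsOrder O) {J : Submodule ℤ A} (hJ : J ≤ Subalgebra.toSubmodule O)
    {x₀ : A} (hx₀ : x₀ ∈ J) (h₀ : x₀ ≠ 0) :
    idealNorm φ J ≠ 0 ∧ (∀ x ∈ J, ∃ k : ℤ, nrd x = idealNorm φ J * k) ∧
      ∀ p : ℕ, p.Prime → ∃ x ∈ J, x ≠ 0 ∧ ∃ N : ℕ, ¬ p ∣ N ∧ nrd x = idealNorm φ J * N := by
  let D : Set ℕ := {d : ℕ | ∀ x ∈ J, x ≠ 0 → ∃ k : ℤ, reducedNorm φ x = (d : ℝ) * k}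
  have hD : ∀ d : ℕ, d ∈ D ↔ ∀ x ∈ J, x ≠ 0 → ∃ k : ℤ, nrd x = d * k := by
    intro d
    refine forall₃_congr fun x _ _ => exists_congr fun k => ?_
    rw [reducedNorm_eq_nrd]
    exact_mod_cast Iff.rfl
  obtain ⟨n, hn⟩ := nrd_nat φ hO (hJ hx₀)
  have hn0 : 0 < n := by
    have := nrd_pos φ h₀
    rw [hn] at this
    exact_mod_cast this
  have hbdd : BddAbove D := by
    refine ⟨n, fun d hd => ?_⟩
    obtain ⟨k, hk⟩ := (hD d).mp hd x₀ hx₀ h₀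
    rw [hn] at hk
    have : (d : ℤ) ∣ n := ⟨k, by exact_mod_cast hk⟩
    exact Nat.le_of_dvd hn0 (Int.natCast_dvd_natCast.mp this)
  have h1 : 1 ∈ D := (hD 1).mpr fun x hx _ => by
    obtain ⟨k, hk⟩ := nrd_int φ hO (hJ hx)
    exact ⟨k, by simpa using hk⟩
  have hmem : idealNorm φ J ∈ D := Nat.sSup_mem ⟨1, h1⟩ hbdd
  have hpos : 0 < idealNorm φ J := lt_of_lt_of_le one_pos (le_csSup hbdd h1)
  rw [hD] at hmem
  refine ⟨hpos.ne', fun x hx => ?_, fun p hp => ?_⟩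
  · rcases eq_or_ne x 0 with rfl | h
    · exact ⟨0, by simp [nrd]⟩
    · exact hmem x hx h
  -- Otherwise `p` times the ideal norm would still divide every norm, contradicting maximality of
  -- the divisor.
  · by_contra! hcon
    have hmul : p * idealNorm φ J ∈ D := (hD _).mpr fun x hx hx0 => by
      obtain ⟨k, hk⟩ := hmem x hx hx0
      have hk0 : 0 ≤ k := by
        have := nrd_pos φ hx0
        rw [hk] at this
        have : (0 : ℚ) < k := pos_of_mul_pos_right this (by positivity)
        exact_mod_cast this.le
      lift k to ℕ using hk0
      obtain ⟨m, rfl⟩ : p ∣ k := by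
        by_contra hpk
        exact hcon x hx hx0 k hpk (by simpa using hk)
      refine ⟨m, ?_⟩
      rw [hk]
      push_cast
      ring
    have := le_csSup hbdd hmul
    change p * idealNorm φ J ≤ idealNorm φ J at this
    nlinarith [hp.two_le]

/-- The multiplication of a left ideal by the conjugate of one of its elements. -/
theorem smul_mem_mulR (hO : IsMaximalOrder O) {J : Submodule ℤ A}
    (hJ : J ≤ Subalgebra.toSubmodule O) (hl : ∀ a ∈ O, ∀ y ∈ J, a * y ∈ J)
    {x : A} (hx : x ∈ J) (h₀ : x ≠ 0) {N : ℕ} (hN : nrd x = idealNorm φ J * N)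
    {y : A} (hy : y ∈ J) : (N : ℤ) • y ∈ mulR (Subalgebra.toSubmodule O) x := by
  obtain ⟨hg, hdvd, -⟩ := idealNorm_spec φ hO.prop hJ hx h₀
  set g := idealNorm φ J
  have hg' : (g : ℚ) ≠ 0 := by exact_mod_cast hg
  -- The trace form is `n(u + x) - n(u) - n(x)`, and each term is divisible by `g`.
  have key : ∀ u ∈ J, ∃ k : ℤ, trd (u * conj x) = g * k := by
    intro u hu
    obtain ⟨k₁, h₁⟩ := hdvd _ (J.add_mem hu hx)
    obtain ⟨k₂, h₂⟩ := hdvd _ hu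
    obtain ⟨k₃, h₃⟩ := hdvd _ hx
    rw [nrd_add φ, h₂, h₃] at h₁
    refine ⟨k₁ - k₂ - k₃, ?_⟩
    push_cast
    linarith
  -- Multiplying this element on the right by `x` gives `(n(x)/g)·y = N·y`, as required.
  have hw : (g : ℚ)⁻¹ • (y * conj x) ∈ O := by
    refine mem_of_maximal φ hO ?_ fun a ha => ?_
    · obtain ⟨k₂, h₂⟩ := hdvd _ hy
      obtain ⟨k₃, h₃⟩ := hdvd _ hx
      refine ⟨k₂ * k₃, ?_⟩
      rw [nrd_smul φ, nrd_mul φ, nrd_conj φ, h₂, h₃]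
      push_cast
      field_simp
    · obtain ⟨k, hk⟩ := key _ (hl a ha y hy)
      refine ⟨k, ?_⟩
      rw [mul_smul_comm, map_smul, ← mul_assoc, hk, smul_eq_mul, inv_mul_cancel_left₀ hg']
  refine ⟨_, hw, ?_⟩
  rw [LinearMap.mulRight_apply, smul_mul_assoc, mul_assoc, conj_mul_self φ, hN,
    ← Algebra.commutes, ← Algebra.smul_def, smul_smul, inv_mul_cancel_left₀ hg',
    ← Int.cast_smul_eq_zsmul ℚ]
  simp

theorem isLattice_map {L : Submodule ℤ A} [Submodule.IsLattice ℚ L] {f : A →ₗ[ℚ] A}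
    (hf : Function.Surjective f) : Submodule.IsLattice ℚ (L.map (f.restrictScalars ℤ)) where
  fg := (Submodule.IsLattice.fg (A := ℚ)).map _
  span_eq_top := by
    rw [Submodule.map_coe, LinearMap.coe_restrictScalars, Submodule.span_image,
      Submodule.IsLattice.span_eq_top, Submodule.map_top, LinearMap.range_eq_top.mpr hf]

theorem isLattice_mulL {L : Submodule ℤ A} [Submodule.IsLattice ℚ L] {z : A} (hz : IsUnit z) :
    Submodule.IsLattice ℚ (mulL z L) :=
  isLattice_map (f := LinearMap.mulLeft ℚ z) fun y => by
    obtain ⟨u, rfl⟩ := hz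
    exact ⟨u⁻¹ * y, by simp⟩

theorem isLattice_mulR {L : Submodule ℤ A} [Submodule.IsLattice ℚ L] {z : A} (hz : IsUnit z) :
    Submodule.IsLattice ℚ (mulR L z) :=
  isLattice_map (f := LinearMap.mulRight ℚ z) fun y => by
    obtain ⟨u, rfl⟩ := hz
    exact ⟨y * u⁻¹, by simp⟩

/-- For a submodule `M'` agreeing with `M` at `p`, the indices of the images under a map agree
at `p`. -/
theorem idx_map_self_mul {A : Type*} [AddCommGroup A] {M M' : Submodule ℤ A} (hM : M.FG)
    (h : M' ≤ M) {N p : ℕ} (hp : p.Prime) (hN : ¬ p ∣ N) (hNM : ∀ x ∈ M, (N : ℤ) • x ∈ M')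
    (f : A →ₗ[ℤ] A) :
    ∃ u v, ¬ p ∣ u ∧ ¬ p ∣ v ∧ idx (M'.map f) M' * u = idx (M.map f) M * v := by
  -- Both products are the index of `f M' ∩ M'` in `M`, through `M'` on one side and through `f M ∩
  -- M` on the other.
  refine ⟨idx M' M, idx (M'.map f ⊓ M') (M.map f ⊓ M), not_dvd_idx hM hp hN hNM,
    not_dvd_idx (hM.of_le inf_le_right) hp hN ?_, ?_⟩
  · rintro _ ⟨⟨x, hx, rfl⟩, hx'⟩
    exact ⟨⟨(N : ℤ) • x, hNM x hx, map_smul f _ _⟩, hNM _ hx'⟩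
  · rw [← idx_inf_left (M'.map f), ← idx_inf_left (M.map f), idx_mul_idx inf_le_right h, mul_comm,
      idx_mul_idx (inf_le_inf (Submodule.map_mono h) h) inf_le_right]

end IdealNorm

/-! ### The index of an integral left ideal -/

section Index

variable {A : Type*} [Ring A]

theorem mulR_mulR (x y : A) (J : Submodule ℤ A) : mulR (mulR J x) y = mulR J (x * y) := by
  rw [mulR, mulR, mulR, ← Submodule.map_comp, ← LinearMap.mulRight_mul]

theorem mulL_mulR (x y : A) (J : Submodule ℤ A) : mulL x (mulR J y) = mulR (mulL x J) y := by
  rw [mulR, mulL, mulR, mulL, ← Submodule.map_comp, ← Submodule.map_comp]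
  congr 1
  ext
  simp [mul_assoc]

theorem mulR_one (J : Submodule ℤ A) : mulR J 1 = J := by
  rw [mulR, LinearMap.mulRight_one, Submodule.map_id]

variable [Algebra ℚ A]

/-- The square of the ideal norm of an integral left ideal is its index. -/
theorem idx_eq_idealNorm_sq (φ : ℝ ⊗[ℚ] A ≃ₐ[ℝ] ℍ[ℝ]) {O : Subalgebra ℤ A}
    (hO : IsMaximalOrder O) {J : Submodule ℤ A} (hJ : J ≤ Subalgebra.toSubmodule O)
    (hl : ∀ a ∈ O, ∀ y ∈ J, a * y ∈ J) {x₀ : A} (hx₀ : x₀ ∈ J) (h₀ : x₀ ≠ 0) :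
    idx J (Subalgebra.toSubmodule O) = idealNorm φ J ^ 2 := by
  have hlat : Submodule.IsLattice ℚ (Subalgebra.toSubmodule O) := hO.prop
  refine eq_of_forall_prime fun p hp => ?_
  obtain ⟨x, hx, hx0, N, hpN, hN⟩ := (idealNorm_spec φ hO.prop hJ hx₀ h₀).2.2 p hp
  have hle : mulR (Subalgebra.toSubmodule O) x ≤ J := by
    rintro _ ⟨a, ha, rfl⟩
    exact hl a ha x hx
  -- The chain `Ox ⊆ J ⊆ O` has total index `n(x)² = g²N²`, and its lower step is prime to `p`.
  refine ⟨idx (mulR (Subalgebra.toSubmodule O) x) J, N ^ 2, ?_, fun h => hpN (hp.dvd_of_dvd_pow h),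
    ?_⟩
  · exact not_dvd_idx (hlat.fg.of_le hJ) hp hpN fun y hy => smul_mem_mulR φ hO hJ hl hx hx0 hN hy
  · rw [mul_comm, idx_mul_idx hle hJ]
    have h := idx_mulR_self φ hO.prop (hJ hx) hx0
    rw [hN] at h
    have h' : (idx (mulR (Subalgebra.toSubmodule O) x) (Subalgebra.toSubmodule O) : ℚ) =
        ((idealNorm φ J ^ 2 * N ^ 2 : ℕ) : ℚ) := by
      rw [h]
      push_cast
      ring
    exact_mod_cast h'

theorem idx_mulL_natCast (φ : ℝ ⊗[ℚ] A ≃ₐ[ℝ] ℍ[ℝ]) {L : Submodule ℤ A}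
    [Submodule.IsLattice ℚ L] {c : ℕ} (hc : IsUnit (c : A)) (h : mulL (c : A) L ≤ L) :
    idx (mulL (c : A) L) L = c ^ 4 := by
  have := idx_mulL_self φ hc h
  rw [nrd_natCast φ] at this
  have h' : (idx (mulL (c : A) L) L : ℚ) = ((c ^ 4 : ℕ) : ℚ) := by
    rw [this]
    push_cast
    ring
  exact_mod_cast h'

end Index

/-! ### The index formula -/

section Main

variable {A : Type*} [Ring A]

/-- The integral left ideal `c (O z⁻¹ + O)`. -/
def scaledSum (O : Subalgebra ℤ A) (z : Aˣ) (c : ℕ) : Submodule ℤ A :=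
  mulL (c : A) (mulR (Subalgebra.toSubmodule O) (↑z⁻¹ : A) ⊔ Subalgebra.toSubmodule O)

/-- The right ideal `O ∩ z O`. -/
def infMulL (O : Subalgebra ℤ A) (z : A) : Submodule ℤ A :=
  Subalgebra.toSubmodule O ⊓ mulL z (Subalgebra.toSubmodule O)

theorem mul_mem_sup {O : Subalgebra ℤ A} {z : A} {a y : A} (ha : a ∈ O)
    (hy : y ∈ mulR (Subalgebra.toSubmodule O) z ⊔ Subalgebra.toSubmodule O) :
    a * y ∈ mulR (Subalgebra.toSubmodule O) z ⊔ Subalgebra.toSubmodule O := by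
  obtain ⟨_, ⟨u, hu, rfl⟩, v, hv, rfl⟩ := Submodule.mem_sup.mp hy
  refine Submodule.mem_sup.mpr ⟨_, ⟨a * u, O.mul_mem ha hu, rfl⟩, a * v, O.mul_mem ha hv, ?_⟩
  simp [mul_add, mul_assoc]

theorem mul_mem_scaledSum {O : Subalgebra ℤ A} {z : Aˣ} {c : ℕ} (a : A) (ha : a ∈ O) (y : A)
    (hy : y ∈ scaledSum O z c) : a * y ∈ scaledSum O z c := by
  obtain ⟨y, hy, rfl⟩ := hy
  refine ⟨a * y, mul_mem_sup ha hy, ?_⟩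
  simp only [LinearMap.mulLeft_apply]
  rw [← mul_assoc, (Nat.cast_commute c a).eq, mul_assoc]

theorem natCast_mem_scaledSum (O : Subalgebra ℤ A) (z : Aˣ) (c : ℕ) :
    (c : A) ∈ scaledSum O z c :=
  ⟨1, Submodule.mem_sup_right O.one_mem, mul_one _⟩

theorem natCast_mul_inv_mem_scaledSum (O : Subalgebra ℤ A) (z : Aˣ) (c : ℕ) :
    (c : A) * ↑z⁻¹ ∈ scaledSum O z c :=
  ⟨↑z⁻¹, Submodule.mem_sup_left ⟨1, O.one_mem, one_mul _⟩, rfl⟩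

/-- Right multiplication by `z⁻¹` turns `[L : L ∩ Lz]` into `[Lz⁻¹ : Lz⁻¹ ∩ L]`; the second
isomorphism theorem does the rest. -/
theorem idx_mulR_eq_idx_sup (L : Submodule ℤ A) (z : Aˣ) :
    idx (mulR L (z : A)) L = idx L (mulR L (↑z⁻¹ : A) ⊔ L) := by
  rw [idx_sup_right, ← idx_mulR (z⁻¹).isUnit, mulR_mulR, Units.mul_inv, mulR_one]

/-- If `y = zl` with `y, l ∈ O`, then `(uz⁻¹ + v)y = ul + vy ∈ O`. -/
theorem mulL_infMulL_le {O : Subalgebra ℤ A} {z : Aˣ} {c : ℕ} {x : A}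
    (hx : x ∈ scaledSum O z c) :
    mulL x (infMulL O z) ≤ mulL (c : A) (Subalgebra.toSubmodule O) := by
  obtain ⟨w, hw, rfl⟩ := hx
  obtain ⟨_, ⟨u, hu, rfl⟩, v, hv, rfl⟩ := Submodule.mem_sup.mp hw
  rintro _ ⟨y, ⟨hy, ⟨l, hl, rfl⟩⟩, rfl⟩
  refine ⟨u * l + v * (z * l), O.add_mem (O.mul_mem hu hl) (O.mul_mem hv hy), ?_⟩
  simp [mul_assoc, add_mul]

variable [Algebra ℚ A]

theorem isUnit_natCast {c : ℕ} (hc : 0 < c) : IsUnit (c : A) := by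
  rw [← map_natCast (algebraMap ℚ A)]
  exact (IsUnit.mk0 (c : ℚ) (by positivity)).map _

/-- A converse to `mulL_infMulL_le` up to the factor `N`. Since `c` and `cz⁻¹` lie in `J`, there are
`o, o' ∈ O` with `ox = Nc` and `o'x = Ncz⁻¹`. Hence `o = zo'` lies in `O ∩ zO`, and `xo = Nc`
because `c` is central. -/
theorem smul_mem_mulL_infMulL (φ : ℝ ⊗[ℚ] A ≃ₐ[ℝ] ℍ[ℝ]) {O : Subalgebra ℤ A}
    (hO : IsMaximalOrder O) {z : Aˣ} {c : ℕ} (hJ : scaledSum O z c ≤ Subalgebra.toSubmodule O)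
    {x : A} (hx : x ∈ scaledSum O z c) (hx0 : x ≠ 0) {N : ℕ}
    (hN : nrd x = idealNorm φ (scaledSum O z c) * N)
    {y : A} (hy : y ∈ mulL (c : A) (Subalgebra.toSubmodule O)) :
    (N : ℤ) • y ∈ mulL x (infMulL O z) := by
  obtain ⟨l, hl, rfl⟩ := hy
  obtain ⟨o, ho, h₁⟩ := smul_mem_mulR φ hO hJ mul_mem_scaledSum hx hx0 hN
    (natCast_mem_scaledSum O z c)
  obtain ⟨o', ho', h₂⟩ := smul_mem_mulR φ hO hJ mul_mem_scaledSum hx hx0 hN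
    (natCast_mul_inv_mem_scaledSum O z c)
  simp only [LinearMap.mulRight_apply] at h₁ h₂
  have hu := isUnit_of_ne_zero φ hx0
  have hoo : z * o' = o := by
    apply hu.mul_right_cancel
    rw [mul_assoc, h₂, h₁, mul_smul_comm, ← mul_assoc, ← (Nat.cast_commute c (z : A)).eq, mul_assoc,
      Units.mul_inv, mul_one]
  have hxo : x * o = (N : ℤ) • (c : A) := by
    apply hu.mul_right_cancel
    rw [mul_assoc, h₁, mul_smul_comm, smul_mul_assoc, (Nat.cast_commute c x).eq]
  refine ⟨o * l, ⟨O.mul_mem ho hl, o' * l, O.mul_mem ho' hl, ?_⟩, ?_⟩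
  · rw [LinearMap.mulLeft_apply, ← mul_assoc, hoo]
  · rw [LinearMap.mulLeft_apply, LinearMap.mulLeft_apply, ← mul_assoc, hxo, smul_mul_assoc]

theorem idx_infMulL_mul (φ : ℝ ⊗[ℚ] A ≃ₐ[ℝ] ℍ[ℝ]) {O : Subalgebra ℤ A}
    (hO : IsMaximalOrder O) {z : Aˣ} {c : ℕ} (hc : 0 < c)
    (hJ : scaledSum O z c ≤ Subalgebra.toSubmodule O) :
    idx (infMulL O z) (Subalgebra.toSubmodule O) * idealNorm φ (scaledSum O z c) ^ 2 = c ^ 4 := by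
  have hlat : Submodule.IsLattice ℚ (Subalgebra.toSubmodule O) := hO.prop
  have hcu : IsUnit (c : A) := isUnit_natCast hc
  have : Nontrivial A := (toHamilton φ).toRingHom.domain_nontrivial
  have hc0 := hcu.ne_zero
  refine eq_of_forall_prime fun p hp => ?_
  obtain ⟨x, hx, hx0, N, hpN, hN⟩ :=
    (idealNorm_spec φ hO.prop hJ (natCast_mem_scaledSum O z c) hc0).2.2 p hp
  have hu := isUnit_of_ne_zero φ hx0
  have hle : mulL x (Subalgebra.toSubmodule O) ≤ Subalgebra.toSubmodule O := by
    rintro _ ⟨a, ha, rfl⟩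
    exact O.mul_mem (hJ hx) ha
  have hcle : mulL (c : A) (Subalgebra.toSubmodule O) ≤ Subalgebra.toSubmodule O := by
    rintro _ ⟨a, ha, rfl⟩
    exact O.mul_mem (natCast_mem O c) ha
  refine ⟨N ^ 2, idx (mulL x (infMulL O z)) (mulL (c : A) (Subalgebra.toSubmodule O)),
    fun h => hpN (hp.dvd_of_dvd_pow h), ?_, ?_⟩
  · exact not_dvd_idx (hlat.fg.of_le hcle) hp hpN
      fun y hy => smul_mem_mulL_infMulL φ hO hJ hx hx0 hN hy
  · have h := idx_mulL_self φ hu hle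
    rw [hN] at h
    have h' : idx (mulL x (Subalgebra.toSubmodule O)) (Subalgebra.toSubmodule O) =
        idealNorm φ (scaledSum O z c) ^ 2 * N ^ 2 := by
      rw [← mul_pow]
      exact_mod_cast h
    -- Both sides compute `[O : xP]`: one through `xO`, the other through `cO`.
    rw [mul_assoc, ← h', ← idx_mulL_natCast φ hcu hcle, mul_comm (idx (mulL (c : A) _) _),
      idx_mul_idx (mulL_infMulL_le hx) hcle, ← idx_mulL hu (infMulL O z),
      idx_mul_idx (show mulL x (infMulL O z) ≤ mulL x (Subalgebra.toSubmodule O) from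
        Submodule.map_mono inf_le_left) hle]

/-- At each prime `xP` agrees with `cO`, and left translation by a unit does not affect the index of
a right translate. -/
theorem idx_mulR_infMulL (φ : ℝ ⊗[ℚ] A ≃ₐ[ℝ] ℍ[ℝ]) {O : Subalgebra ℤ A}
    (hO : IsMaximalOrder O) {z : Aˣ} {c : ℕ} (hc : 0 < c)
    (hJ : scaledSum O z c ≤ Subalgebra.toSubmodule O) :
    idx (mulR (infMulL O z) z) (infMulL O z) =
      idx (mulR (Subalgebra.toSubmodule O) z) (Subalgebra.toSubmodule O) := by
  have hlat : Submodule.IsLattice ℚ (Subalgebra.toSubmodule O) := hO.prop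
  have hcu : IsUnit (c : A) := isUnit_natCast hc
  have : Nontrivial A := (toHamilton φ).toRingHom.domain_nontrivial
  refine eq_of_forall_prime fun p hp => ?_
  obtain ⟨x, hx, hx0, N, hpN, hN⟩ :=
    (idealNorm_spec φ hO.prop hJ (natCast_mem_scaledSum O z c) hcu.ne_zero).2.2 p hp
  obtain ⟨u, v, hu, hv, h⟩ := idx_map_self_mul (hlat.fg.map (LinearMap.mulLeft ℤ (c : A)))
    (mulL_infMulL_le hx) hp hpN (fun y hy => smul_mem_mulL_infMulL φ hO hJ hx hx0 hN hy)
    (LinearMap.mulRight ℤ (z : A))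
  refine ⟨u, v, hu, hv, ?_⟩
  rw [← idx_mulL (isUnit_of_ne_zero φ hx0) (mulR _ _),
    ← idx_mulL hcu (mulR (Subalgebra.toSubmodule O) z), mulL_mulR, mulL_mulR]
  exact h

/-- The left order contains `O`, and it lies in the ideal because `1` does; so it is finitely
generated, hence an order, and maximality gives equality. -/
theorem isLeftFractionalIdeal_sup {O : Subalgebra ℤ A} (hO : IsMaximalOrder O) (z : A) :
    IsLeftFractionalIdeal O (mulR (Subalgebra.toSubmodule O) z ⊔ Subalgebra.toSubmodule O) := by
  have hlat : Submodule.IsLattice ℚ (Subalgebra.toSubmodule O) := hO.prop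
  have hfg := (hlat.fg.map (LinearMap.mulRight ℤ z)).sup hlat.fg
  refine ⟨Submodule.IsLattice.of_le_of_isLattice_of_fg ℚ
    (M := Subalgebra.toSubmodule O) le_sup_right hfg, ?_⟩
  set I := mulR (Subalgebra.toSubmodule O) z ⊔ Subalgebra.toSubmodule O
  have hle : O ≤ leftOrder I := fun a ha y hy => mul_mem_sup ha hy
  have hleI : Subalgebra.toSubmodule (leftOrder I) ≤ I := fun a ha => by
    simpa using ha 1 (Submodule.mem_sup_right O.one_mem)
  refine le_antisymm (hO.2 ?_ hle) hle
  exact Submodule.IsLattice.of_le_of_isLattice_of_fg ℚ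
    (M := Subalgebra.toSubmodule O) hle (Submodule.FG.of_le hfg hleI)

theorem exists_scaledSum_le {O : Subalgebra ℤ A} (hO : IsOrder O) (z : Aˣ) :
    ∃ c : ℕ, 0 < c ∧ scaledSum O z c ≤ Subalgebra.toSubmodule O := by
  obtain ⟨c, hc, h⟩ := exists_natCast_mul_mem hO (↑z⁻¹ : A)
  refine ⟨c, hc, ?_⟩
  rintro _ ⟨w, hw, rfl⟩
  obtain ⟨_, ⟨u, hu, rfl⟩, v, hv, rfl⟩ := Submodule.mem_sup.mp hw
  have : (c : A) * (u * ↑z⁻¹ + v) = u * (c * ↑z⁻¹) + c * v := by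
    rw [mul_add, ← mul_assoc, (Nat.cast_commute c u).eq, mul_assoc]
  change (c : A) * (u * ↑z⁻¹ + v) ∈ O
  rw [this]
  exact O.add_mem (O.mul_mem hu h) (O.mul_mem (natCast_mem O c) hv)

/-- The main index formula, for a unit `z`. -/
theorem index_mul_fractionalNorm (φ : ℝ ⊗[ℚ] A ≃ₐ[ℝ] ℍ[ℝ]) {O : Subalgebra ℤ A}
    (hO : IsMaximalOrder O) (z : Aˣ) {Λ : Submodule ℤ A}
    (hΛ : Λ = Subalgebra.toSubmodule O ⊓ mulL z (Subalgebra.toSubmodule O) ⊓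
      mulR (Subalgebra.toSubmodule O) z ⊓ mulL z (mulR (Subalgebra.toSubmodule O) z)) :
    Submodule.IsLattice ℚ Λ ∧ Λ ≤ Subalgebra.toSubmodule O ∧
    IsLeftFractionalIdeal O
      (mulR (Subalgebra.toSubmodule O) (↑z⁻¹ : A) ⊔ Subalgebra.toSubmodule O) ∧
    (Λ.toAddSubgroup.relIndex (Subalgebra.toSubmodule O).toAddSubgroup : ℝ) *
      fractionalNorm φ O
        (mulR (Subalgebra.toSubmodule O) (↑z⁻¹ : A) ⊔ Subalgebra.toSubmodule O) ^ 4 = 1 := by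
  have hlat : Submodule.IsLattice ℚ (Subalgebra.toSubmodule O) := hO.prop
  have hΛ' : Λ = mulR (infMulL O z) z ⊓
      infMulL O z := by
    rw [hΛ, infMulL, mulL_mulR]
    conv_rhs =>
      rw [mulR, Submodule.map_inf _ (fun _ _ h => z.isUnit.mul_right_cancel h)]
    rw [inf_comm (Submodule.map _ _ ⊓ _), inf_assoc]
    rfl
  refine ⟨?_, ?_, isLeftFractionalIdeal_sup hO _, ?_⟩
  · have h₁ := isLattice_mulL (L := Subalgebra.toSubmodule O) z.isUnit
    have h₂ := isLattice_mulR (L := Subalgebra.toSubmodule O) z.isUnit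
    have h₃ := isLattice_mulL
      (L := mulR (Subalgebra.toSubmodule O) z) z.isUnit
    have := finite_of_identification φ
    rw [hΛ]
    infer_instance
  · rw [hΛ]
    exact inf_le_left.trans (inf_le_left.trans inf_le_left)
  obtain ⟨c, hc, hJ⟩ := exists_scaledSum_le hO.prop z
  have hcu : IsUnit (c : A) := isUnit_natCast hc
  have : Nontrivial A := (toHamilton φ).toRingHom.domain_nontrivial
  have hcJ := natCast_mem_scaledSum O z c
  rw [fractionalNorm_eq φ hO.prop hc hJ,
    reducedNorm_natCast]
  have hP := idx_infMulL_mul φ hO hc hJ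
  -- Here `c⁴ = [O : cO]` is split along `cO ⊆ J ⊆ O`, with `[O : J] = g²`.
  have hb : idx (mulR (Subalgebra.toSubmodule O) (z : A))
      (Subalgebra.toSubmodule O) *
      idealNorm φ (scaledSum O z c) ^ 2 = c ^ 4 := by
    have hcle : mulL (c : A) (Subalgebra.toSubmodule O) ≤
        Subalgebra.toSubmodule O := by
      rintro _ ⟨a, ha, rfl⟩
      exact O.mul_mem (natCast_mem O c) ha
    rw [← idx_eq_idealNorm_sq φ hO hJ
      mul_mem_scaledSum hcJ hcu.ne_zero,
      idx_mulR_eq_idx_sup, ← idx_mulL hcu,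
      ← idx_mulL_natCast φ hcu hcle]
    exact idx_mul_idx (Submodule.map_mono le_sup_right) hJ
  have hΛi : Λ.toAddSubgroup.relIndex (Subalgebra.toSubmodule O).toAddSubgroup =
      idx (mulR (Subalgebra.toSubmodule O) (z : A))
        (Subalgebra.toSubmodule O) *
      idx (infMulL O z) (Subalgebra.toSubmodule O) := by
    change idx Λ _ = _
    rw [← idx_mulR_infMulL φ hO hc hJ,
      ← idx_inf_left (mulR (infMulL O z) (z : A)), ← hΛ',
      idx_mul_idx (hΛ'.le.trans inf_le_right)
        (show infMulL O (z : A) ≤ Subalgebra.toSubmodule O from inf_le_left)]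
  rw [hΛi]
  change _ * ((idealNorm φ (scaledSum O z c) : ℝ) / _) ^ 4 = 1
  generalize idealNorm φ (scaledSum O z c) = g at *
  generalize idx (mulR (Subalgebra.toSubmodule O) (z : A))
    (Subalgebra.toSubmodule O) = a at *
  generalize idx (infMulL O z)
    (Subalgebra.toSubmodule O) = b at *
  have h₁ : (a : ℝ) * g ^ 2 = c ^ 4 := by exact_mod_cast hb
  have h₂ : (b : ℝ) * g ^ 2 = c ^ 4 := by exact_mod_cast hP
  have hc' : (c : ℝ) ≠ 0 := by positivity
  push_cast
  rw [div_pow, ← mul_div_assoc, div_eq_one_iff_eq (by positivity)]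
  calc (a : ℝ) * b * (g : ℝ) ^ 4 = (a * (g : ℝ) ^ 2) * (b * (g : ℝ) ^ 2) := by ring
    _ = ((c : ℝ) ^ 2) ^ 4 := by rw [h₁, h₂]; ring

end Main

end DefiniteQuaternion

theorem mainTheorem8 {A : Type*} [Ring A] [Algebra ℚ A]
    (hA : DefiniteQuaternion.IsQuaternionAlgebra ℚ A)
    (φ : ℝ ⊗[ℚ] A ≃ₐ[ℝ] ℍ[ℝ])
    (O : Subalgebra ℤ A) (hO : DefiniteQuaternion.IsMaximalOrder O)
    (z : A) (hz : z ≠ 0)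
    (L Λ I : Submodule ℤ A)
    (hL : L = Subalgebra.toSubmodule O)
    (hΛ : Λ = L ⊓ DefiniteQuaternion.mulL z L ⊓ DefiniteQuaternion.mulR L z ⊓
      DefiniteQuaternion.mulL z (DefiniteQuaternion.mulR L z))
    (hI : I = DefiniteQuaternion.mulR L (Ring.inverse z) ⊔ L) :
    Submodule.IsLattice ℚ Λ ∧ Λ ≤ L ∧
    DefiniteQuaternion.IsLeftFractionalIdeal O I ∧
    (Λ.toAddSubgroup.relIndex L.toAddSubgroup : ℝ) *
      DefiniteQuaternion.fractionalNorm φ O I ^ 4 = 1 := by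
  -- The norm form is positive definite, so `z` is invertible and `Ring.inverse z` is its true
  -- inverse.
  obtain ⟨z, rfl⟩ := DefiniteQuaternion.isUnit_of_ne_zero φ hz
  rw [Ring.inverse_unit] at hI
  subst hL hI
  exact DefiniteQuaternion.index_mul_fractionalNorm φ hO z hΛ
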